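/- The following two statements are equivalent. (a) (Jacobian conjecture, in all dimensions.) For every $n\ge 1$ and every polynomial map $F=(F_1,\dots,F_n):\mathbb C^n\to\mathbb C^n$ whose Jacobian determinant $\det(\partial F_i/\partial z_j)$ is equal to $1$, there is a polynomial map $G:\mathbb C^n\to\mathbb C^n$ with $F(G(z))=z$ and $G(F(z))=z$. (b) For every $n\ge 1$ and every homogeneous polynomial $P\in\mathbb C[z_1,\dots,z_n]$ of degree $4$ whose Hessian matrix $(\partial^2P/\partial z_i\partial z_j)$ is nilpotent, the unique formal power series $U_t(z)\in\mathbb C[[z_1,\dots,z_n,t]]$ with $$\frac{\partial U_t}{\partial t}=\frac12\langle\nabla U_t,\nabla U_t\rangle,\qquad U_{t=0}(z)=P(z)$$ is a polynomial in $z_1,\dots,z_n$ and $t$. Here $\nabla$ is the gradient with respect to $z$, and $\langle u,v\rangle=\sum_{i=1}^n u_iv_i$ is the standard $\mathbb C$-bilinear form. Moreover, for each $P$ as in (b) such a formal power series $U_t(z)$ exists and is unique. -/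

import Mathlib

noncomputable section

namespace InviscidBurgers

/-- The Jacobian matrix `(∂F_i/∂z_j)` of a polynomial map `F = (F_1, …, F_n)`. -/
def jacobianMatrix {n : ℕ} (F : Fin n → MvPolynomial (Fin n) ℂ) :
    Matrix (Fin n) (Fin n) (MvPolynomial (Fin n) ℂ) :=
  Matrix.of fun i j => MvPolynomial.pderiv j (F i)

/-- The polynomial maps `F` and `G` from `ℂⁿ` to `ℂⁿ` are inverse to each other:
`F(G(z)) = z` and `G(F(z)) = z`. -/
def AreInverse {n : ℕ} (F G : Fin n → MvPolynomial (Fin n) ℂ) : Prop :=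
  (∀ i, MvPolynomial.bind₁ G (F i) = MvPolynomial.X i) ∧
    ∀ i, MvPolynomial.bind₁ F (G i) = MvPolynomial.X i

/-- The Jacobian conjecture over `ℂ`, in all dimensions: a polynomial map with Jacobian
determinant `1` has a polynomial inverse. -/
def JacobianConjecture : Prop :=
  ∀ n : ℕ, 1 ≤ n → ∀ F : Fin n → MvPolynomial (Fin n) ℂ,
    (jacobianMatrix F).det = 1 → ∃ G : Fin n → MvPolynomial (Fin n) ℂ, AreInverse F G

/-- The gradient of a polynomial. -/
def polyGradient {n : ℕ} (P : MvPolynomial (Fin n) ℂ) : Fin n → MvPolynomial (Fin n) ℂ :=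
  fun i => MvPolynomial.pderiv i P

/-- The Hessian matrix of a polynomial, that is, the Jacobian matrix of its gradient. -/
def hessian {n : ℕ} (P : MvPolynomial (Fin n) ℂ) :
    Matrix (Fin n) (Fin n) (MvPolynomial (Fin n) ℂ) :=
  jacobianMatrix (polyGradient P)

/-- Formal power series in `z_1, …, z_n` and `t`: the variable `z_i` has the index `some i`,
the variable `t` has the index `none`. -/
abbrev SeriesZT (n : ℕ) : Type := MvPowerSeries (Option (Fin n)) ℂ

/-- The gradient of `U_t(z)` with respect to `z` alone. -/
def gradientZ {n : ℕ} (U : SeriesZT n) : Fin n → SeriesZT n :=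
  fun i => MvPowerSeries.pderiv ℂ (some i) U

/-- The power series `U_{t=0}(z)` in `z` alone. -/
def atTimeZero {n : ℕ} (U : SeriesZT n) : MvPowerSeries (Fin n) ℂ :=
  fun m => MvPowerSeries.coeff (m.mapDomain some) U

/-- `U` is a power series solution of the Cauchy problem `∂U/∂t = ½⟨∇U, ∇U⟩`, `U_{t=0} = P`,
where `⟨·, ·⟩` is the standard bilinear form and `∇` is the gradient with respect to `z`. -/
structure IsCauchySolution {n : ℕ} (P : MvPolynomial (Fin n) ℂ) (U : SeriesZT n) : Prop where
  equation : MvPowerSeries.pderiv ℂ none U = (1 / 2 : ℂ) • (gradientZ U ⬝ᵥ gradientZ U)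
  initial : atTimeZero U = (P : MvPowerSeries (Fin n) ℂ)

/-- The power series `U` in `z` and `t` is a polynomial in `z` and `t`. -/
def IsPolynomialZT {n : ℕ} (U : SeriesZT n) : Prop :=
  ∃ p : MvPolynomial (Option (Fin n)) ℂ, (p : MvPowerSeries (Option (Fin n)) ℂ) = U

/-- For every homogeneous polynomial `P` of degree `d` with nilpotent Hessian, in any number of
variables, the power series solution of the Cauchy problem with initial value `P` is a polynomial
in `z` and `t`. -/
def PolynomialSolutionConjecture (d : ℕ) : Prop :=
  ∀ n : ℕ, 1 ≤ n → ∀ P : MvPolynomial (Fin n) ℂ, P.IsHomogeneous d → IsNilpotent (hessian P) →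
    ∀ U : SeriesZT n, IsCauchySolution P U → IsPolynomialZT U

end InviscidBurgers

end

/-! The link between the two statements is the method of characteristics. Along the lines `z -
t∇P(z)` the gradient of the solution is constant: `∇U(z - t∇P(z), t) = ∇P(z)`
(`characteristicHom_pderiv_of_isCauchySolution`). If `U` is a polynomial, then at `t = 1` the map `w
↦ w + ∇U(w, 1)` is a polynomial left inverse of `z - ∇P(z)`. Conversely, `(z, t) ↦ (z - t∇P(z), t)`
has Jacobian determinant `det(1 - t Hess P) = 1` when the Hessian is nilpotent; the Jacobian
conjecture inverts it, and the Hopf–Lax formula makes a polynomial solution out of the inverse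
(`isCauchySolution_of_inverse_flow`). Uniqueness of the power series solution identifies the two.

So the polynomial solution conjecture yields invertibility of `z - ∇P` for quartic `P` with
nilpotent Hessian, and it remains to reduce the Jacobian conjecture to such maps. Three reductions
do this, each adding variables: lowering the degree to 3, in the manner of Bass–Connell–Wright and
Yagzhev (`BoundedDegreeConjecture.succ`); making the nonlinear part cubic homogeneous
(`CubicHomogeneousConjecture.generates_of_normalized`); and replacing it by a gradient, in the
manner of de Bondt and van den Essen (`isNilpotent_jac_gradient_symmetrization`).

Invertibility is carried in the form `Generates`, existence of a left inverse. It descends from the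
enlarged map to the original one by specializing the added variables (`Generates.of_surjective`),
and it gives a two-sided inverse because polynomial rings are Noetherian. -/

noncomputable section

namespace InviscidBurgers

open MvPolynomial

/-! ### Chain rule, homogeneity and Jacobian matrices -/

section Calculus

/-- The chain rule: a derivation applied to a polynomial expression. -/
theorem derivation_aeval {R A σ : Type*} [CommRing R] [CommRing A] [Algebra R A] [Fintype σ]
    (D : Derivation R A A) (g : σ → A) (p : MvPolynomial σ R) :
    D (aeval g p) = ∑ i, aeval g (pderiv i p) * D (g i) := by
  classical
  induction p using MvPolynomial.induction_on with
  | C a => simp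
  | add p q hp hq => simp [hp, hq, add_mul, Finset.sum_add_distrib]
  | mul_X p i hp =>
    simp only [map_mul, aeval_X, Derivation.leibniz, smul_eq_mul, hp, map_add, pderiv_X, add_mul,
      Finset.sum_add_distrib, Finset.mul_sum]
    congr 1
    · rw [Finset.sum_eq_single i] <;> simp +contextual [eq_comm]
    · exact Finset.sum_congr rfl fun j _ => by ring

theorem aeval_mul_of_isHomogeneous {R A σ : Type*} [CommRing R] [CommRing A] [Algebra R A]
    {p : MvPolynomial σ R} {d : ℕ} (hp : p.IsHomogeneous d) (s : A) (g : σ → A) :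
    aeval (fun i => s * g i) p = s ^ d * aeval g p := by
  simp only [aeval_def, eval₂_eq, Finset.mul_sum]
  refine Finset.sum_congr rfl fun m hm => ?_
  have : ∑ i ∈ m.support, m i = d := by
    rw [← hp.degree_eq_sum_deg_support hm]
  simp only [mul_pow, Finset.prod_mul_distrib, Finset.prod_pow_eq_pow_sum, this]
  ring

/-- The Jacobian matrix of a polynomial map, with arbitrary index types. -/
def jac {R σ τ : Type*} [CommRing R] (F : τ → MvPolynomial σ R) :
    Matrix τ σ (MvPolynomial σ R) :=
  Matrix.of fun i j => pderiv j (F i)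

@[simp]
theorem jac_apply {R σ τ : Type*} [CommRing R] (F : τ → MvPolynomial σ R) (i : τ) (j : σ) :
    jac F i j = pderiv j (F i) := rfl

theorem jac_X {R σ : Type*} [CommRing R] [DecidableEq σ] :
    jac (X : σ → MvPolynomial σ R) = 1 := by
  ext1 i j
  simp [pderiv_X, Pi.single_apply, Matrix.one_apply]

theorem jac_add {R σ τ : Type*} [CommRing R] (F G : τ → MvPolynomial σ R) :
    jac (fun i => F i + G i) = jac F + jac G := by
  ext1 i j; simp

end Calculus

/-! ### Nilpotent matrices and determinants -/

section Nilpotent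

-- The polynomial `det(1 - X M)` is a unit, hence constant over a domain; its values at 0 and at 1
-- therefore agree.
open Polynomial in
theorem det_one_sub_of_isNilpotent {R n : Type*} [CommRing R] [IsDomain R] [Fintype n]
    [DecidableEq n] {M : Matrix n n R} (hM : IsNilpotent M) : (1 - M).det = 1 := by
  obtain ⟨r, -, hr⟩ := Polynomial.isUnit_iff.1 (Matrix.isUnit_charpolyRev_of_isNilpotent hM)
  have h0 := Matrix.eval_charpolyRev (M := M)
  rw [← hr, Polynomial.eval_C] at h0
  have h1 : (1 - M).det = Polynomial.eval 1 M.charpolyRev := by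
    rw [Matrix.charpolyRev, ← Polynomial.coe_evalRingHom, RingHom.map_det]
    congr 1
    ext i j
    simp [Matrix.one_apply, apply_ite]
  rw [h1, ← hr, Polynomial.eval_C, h0]

-- Reversing back shows that the characteristic polynomial is a power of `X`; Cayley–Hamilton
-- concludes.
open Polynomial in
theorem isNilpotent_of_charpolyRev_eq_one {R n : Type*} [CommRing R] [Nontrivial R] [Fintype n]
    [DecidableEq n] {M : Matrix n n R} (hM : M.charpolyRev = 1) : IsNilpotent M := by
  have h1 : M.charpoly = (X : R[X]) ^ M.charpoly.natDegree := by
    rw [← Polynomial.reflect_one, ← hM, ← Matrix.reverse_charpoly, Polynomial.reverse,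
      Polynomial.reflect_reflect]
  refine ⟨M.charpoly.natDegree, ?_⟩
  have := Matrix.aeval_self_charpoly M
  rw [h1] at this
  simpa using this

/-- The entries of `jac H` are homogeneous of degree `d`, so scaling the variables by `s` turns the
hypothesis into `det(1 + s^d jac H) = 1`. This is the reversed characteristic polynomial of `-jac H`
at `s^d`, and `s ↦ s^d` is injective on polynomials as `d ≠ 0`. -/
theorem isNilpotent_jac_of_det_one_add {R σ : Type*} [CommRing R] [IsDomain R] [Fintype σ]
    [DecidableEq σ] {d : ℕ} (hd : d ≠ 0) {H : σ → MvPolynomial σ R}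
    (hH : ∀ i, (H i).IsHomogeneous (d + 1)) (hdet : (1 + jac H).det = 1) :
    IsNilpotent (jac H) := by
  rw [← isNilpotent_neg_iff]
  apply isNilpotent_of_charpolyRev_eq_one
  apply Polynomial.expand_injective (Nat.pos_of_ne_zero hd)
  let φ : MvPolynomial σ R →ₐ[R] Polynomial (MvPolynomial σ R) :=
    aeval fun i => Polynomial.X * Polynomial.C (X i)
  have hφ : ∀ i j, φ (jac H i j) = Polynomial.X ^ d * Polynomial.C (jac H i j) := by
    intro i j
    have h : (jac H i j).IsHomogeneous d := (hH i).pderiv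
    rw [show φ (jac H i j) = _ from aeval_mul_of_isHomogeneous h _ _]
    congr 1
    have : (aeval fun i => Polynomial.C (X i)) =
      (Polynomial.CAlgHom (R := R) (A := MvPolynomial σ R)) := by
      ext i; simp
    rw [this]; rfl
  have h := congrArg φ hdet
  rw [map_one, AlgHom.map_det] at h
  rw [map_one, ← h, Matrix.charpolyRev, AlgHom.map_det]
  congr 1
  ext1 i j
  have hij := hφ i j
  rw [jac_apply] at hij
  by_cases h1 : i = j
  · subst h1; simp [hij]
  · simp [hij, h1]

end Nilpotent

/-! ### Left inverses and two-sided inverses -/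

section Generates

/-- A surjective endomorphism of a Noetherian ring is injective. -/
theorem injective_of_surjective_ringEnd {A : Type*} [CommRing A] [IsNoetherianRing A]
    (f : A →+* A) (hf : Function.Surjective f) : Function.Injective f := by
  let K : ℕ →o Ideal A :=
    ⟨fun n => RingHom.ker (f ^ n), monotone_nat_of_le_succ fun n x hx => by
      rw [RingHom.mem_ker] at hx ⊢
      rw [pow_succ', RingHom.mul_def, RingHom.comp_apply, hx, map_zero]⟩
  obtain ⟨n, hn⟩ := monotone_stabilizes_iff_noetherian.2 ‹IsNoetherianRing A› K
  rw [injective_iff_map_eq_zero]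
  intro x hx
  -- With `x = fⁿ y` and `f x = 0`, the element `y` lies in `ker fⁿ⁺¹ = ker fⁿ`, so `x = 0`.
  have hs : Function.Surjective (f ^ n) := by
    rw [RingHom.coe_pow]; exact hf.iterate n
  obtain ⟨y, rfl⟩ := hs x
  have hy : y ∈ K (n + 1) := by
    change (f ^ (n + 1)) y = 0
    rw [pow_succ', RingHom.mul_def, RingHom.comp_apply, hx]
  rw [← hn (n + 1) n.le_succ] at hy
  exact hy

/-- The components of the polynomial map `F` generate the polynomial algebra, that is, `F` has a
polynomial left inverse. -/
def Generates {σ τ : Type*} (F : τ → MvPolynomial σ ℂ) : Prop :=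
  Algebra.adjoin ℂ (Set.range F) = ⊤

/-- The descent step of every reduction: `ψ` restricts the enlarged map `Φ` to a copy of the
original space, where its components become polynomials in those of `F`. -/
theorem Generates.of_surjective {σ τ σ' τ' : Type*} {F : τ → MvPolynomial σ ℂ}
    {Φ : τ' → MvPolynomial σ' ℂ} (hΦ : Generates Φ)
    (ψ : MvPolynomial σ' ℂ →ₐ[ℂ] MvPolynomial σ ℂ) (hψ : Function.Surjective ψ)
    (h : ∀ k, ψ (Φ k) ∈ Algebra.adjoin ℂ (Set.range F)) : Generates F := by
  unfold Generates at *
  rw [eq_top_iff, ← (AlgHom.range_eq_top ψ).2 hψ, ← Algebra.map_top, ← hΦ, AlgHom.map_adjoin]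
  apply Algebra.adjoin_le
  rintro _ ⟨_, ⟨k, rfl⟩, rfl⟩
  exact h k

theorem surjective_of_forall_X_mem {σ σ' : Type*}
    (ψ : MvPolynomial σ' ℂ →ₐ[ℂ] MvPolynomial σ ℂ) (h : ∀ i, ∃ p, ψ p = X i) :
    Function.Surjective ψ := by
  rw [← AlgHom.range_eq_top, eq_top_iff, ← MvPolynomial.adjoin_range_X]
  apply Algebra.adjoin_le
  rintro _ ⟨i, rfl⟩
  exact h i

theorem Generates.exists_leftInverse {σ τ : Type*} {F : τ → MvPolynomial σ ℂ} (h : Generates F)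
    (i : σ) : ∃ G : MvPolynomial τ ℂ, aeval F G = X i := by
  have : (X i : MvPolynomial σ ℂ) ∈ Algebra.adjoin ℂ (Set.range F) := by
    rw [h]; trivial
  rwa [Algebra.adjoin_range_eq_range_aeval] at this

theorem generates_of_forall_X {σ τ : Type*} {F : τ → MvPolynomial σ ℂ}
    (h : ∀ i, ∃ G : MvPolynomial τ ℂ, aeval F G = X i) : Generates F := by
  unfold Generates
  rw [Algebra.adjoin_range_eq_range_aeval, AlgHom.range_eq_top]
  exact surjective_of_forall_X_mem _ h

/-- A left inverse makes composition with `F` a surjective endomorphism of a Noetherian ring, hence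
an injective one, so `F` can be cancelled from `F ∘ G ∘ F = F`. -/
theorem Generates.exists_areInverse {n : ℕ} {F : Fin n → MvPolynomial (Fin n) ℂ}
    (h : Generates F) : ∃ G, AreInverse F G := by
  choose G hG using h.exists_leftInverse
  have hsurj : Function.Surjective (aeval F : MvPolynomial (Fin n) ℂ →ₐ[ℂ] _) :=
    surjective_of_forall_X_mem _ fun i => ⟨G i, hG i⟩
  have hinj : Function.Injective (aeval F : MvPolynomial (Fin n) ℂ →ₐ[ℂ] _) :=
    injective_of_surjective_ringEnd (aeval F : MvPolynomial (Fin n) ℂ →ₐ[ℂ] _).toRingHom hsurj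
  refine ⟨G, fun i => hinj ?_, hG⟩
  have : (aeval F).comp (aeval G) = AlgHom.id ℂ (MvPolynomial (Fin n) ℂ) := by
    ext1 i; simpa using hG i
  have := DFunLike.congr_fun this (F i)
  simp only [AlgHom.comp_apply, AlgHom.id_apply] at this
  change aeval F (aeval G (F i)) = _
  rw [this, aeval_X]

end Generates

/-- Invertibility of polynomial maps `X + H` with Jacobian determinant `1` and `H` cubic
homogeneous. -/
def CubicHomogeneousConjecture : Prop :=
  ∀ (σ : Type) [Fintype σ] [DecidableEq σ] (H : σ → MvPolynomial σ ℂ),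
    (∀ i, (H i).IsHomogeneous 3) → (1 + jac H).det = 1 → Generates fun i => X i + H i

/-- The Jacobian conjecture for polynomial maps of degree at most `D`. -/
def BoundedDegreeConjecture (D : ℕ) : Prop :=
  ∀ (σ : Type) [Fintype σ] [DecidableEq σ] (F : σ → MvPolynomial σ ℂ),
    (∀ i, (F i).totalDegree ≤ D) → (jac F).det = 1 → Generates F

theorem pderiv_rename_of_notMem_range {R σ τ : Type*} [CommRing R] {f : σ → τ} {k : τ}
    (hk : k ∉ Set.range f) (p : MvPolynomial σ R) : pderiv k (rename f p) = 0 := by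
  induction p using MvPolynomial.induction_on with
  | C a => simp
  | add p q hp hq => simp [hp, hq]
  | mul_X p i hp =>
    have : f i ≠ k := fun h => hk ⟨i, h⟩
    simp [hp, pderiv_X_of_ne this]

/-! ### Reduction to degree at most 3 -/

section DegreeReduction

variable {σ κ : Type} [Fintype κ]

/-- The polynomial map `(F - ∑ c_k (Y_k + a_k) (Z_k + b_k), Y + a, Z + b)`. -/
def splitMap (F : σ → MvPolynomial σ ℂ) (c : σ → κ → ℂ) (a b : κ → MvPolynomial σ ℂ) :
    σ ⊕ (κ ⊕ κ) → MvPolynomial (σ ⊕ (κ ⊕ κ)) ℂ :=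
  Sum.elim
    (fun i => rename Sum.inl (F i) - ∑ k, C (c i k) * ((X (.inr (.inl k)) + rename Sum.inl (a k)) *
      (X (.inr (.inr k)) + rename Sum.inl (b k))))
    (Sum.elim (fun k => X (.inr (.inl k)) + rename Sum.inl (a k))
      (fun k => X (.inr (.inr k)) + rename Sum.inl (b k)))

theorem pderiv_inl_rename_inl {τ : Type} (j : σ) (p : MvPolynomial σ ℂ) :
    pderiv (Sum.inl j : σ ⊕ τ) (rename Sum.inl p) = rename Sum.inl (pderiv j p) :=
  pderiv_rename Sum.inl_injective j p

theorem pderiv_inr_rename_inl {τ : Type} (j : τ) (p : MvPolynomial σ ℂ) :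
    pderiv (Sum.inr j : σ ⊕ τ) (rename Sum.inl p) = 0 :=
  pderiv_rename_of_notMem_range (by simp) p

/-- The lower right block is the identity, so the determinant is that of the Schur complement. Its
correction term restores exactly the product-rule terms of the subtracted products, which leaves
`jac F`. -/
theorem det_jac_splitMap [Fintype σ] [DecidableEq σ] [DecidableEq κ] (F : σ → MvPolynomial σ ℂ)
    (c : σ → κ → ℂ) (a b : κ → MvPolynomial σ ℂ) :
    (jac (splitMap F c a b)).det = rename Sum.inl (jac F).det := by
  have hblock : jac (splitMap F c a b) = Matrix.fromBlocks
      (Matrix.of fun i j => rename Sum.inl (pderiv j (F i)) - ∑ k, C (c i k) *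
        (rename Sum.inl (pderiv j (a k)) * (X (.inr (.inr k)) + rename Sum.inl (b k)) +
          (X (.inr (.inl k)) + rename Sum.inl (a k)) * rename Sum.inl (pderiv j (b k))))
      (Matrix.of fun i => Sum.elim
        (fun k => - (C (c i k) * (X (.inr (.inr k)) + rename Sum.inl (b k))))
        (fun k => - (C (c i k) * (X (.inr (.inl k)) + rename Sum.inl (a k)))))
      (Matrix.of (Sum.elim (fun k j => rename Sum.inl (pderiv j (a k)))
        (fun k j => rename Sum.inl (pderiv j (b k))))) 1 := by
    refine Matrix.ext fun i j => ?_
    rcases i with i | i | i <;> rcases j with j | j | j <;>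
      simp [splitMap, pderiv_inl_rename_inl, pderiv_inr_rename_inl, pderiv_X, Pi.single_apply,
        Matrix.one_apply, -Derivation.leibniz, pderiv_mul, eq_comm]
  rw [hblock, Matrix.det_fromBlocks_one₂₂, AlgHom.map_det]
  congr 1
  ext1 i j
  simp only [Matrix.sub_apply, Matrix.mul_apply, Matrix.of_apply, Fintype.sum_sum_type,
    Sum.elim_inl, Sum.elim_inr, AlgHom.mapMatrix_apply, Matrix.map_apply, jac_apply]
  rw [sub_sub, sub_eq_iff_eq_add, ← sub_eq_iff_eq_add', sub_self, eq_comm,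
    ← Finset.sum_add_distrib, ← Finset.sum_add_distrib]
  exact Finset.sum_eq_zero fun k _ => by ring

/-- On the graph `Y = -a`, `Z = -b` the subtracted products vanish, and the map becomes `(F, 0, 0)`.
-/
theorem generates_of_splitMap {F : σ → MvPolynomial σ ℂ} {c : σ → κ → ℂ}
    {a b : κ → MvPolynomial σ ℂ} (h : Generates (splitMap F c a b)) : Generates F := by
  let ψ : MvPolynomial (σ ⊕ (κ ⊕ κ)) ℂ →ₐ[ℂ] MvPolynomial σ ℂ :=
    aeval (Sum.elim X (Sum.elim (fun k => - a k) (fun k => - b k)))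
  have hι : ∀ p, ψ (rename Sum.inl p) = p := fun p => by
    change aeval _ (rename Sum.inl p) = p
    rw [aeval_rename]
    exact aeval_X_left_apply p
  refine h.of_surjective ψ (fun p => ⟨_, hι p⟩) fun k => ?_
  rcases k with i | k | k
  · have : ψ (splitMap F c a b (.inl i)) = F i := by
      simp [splitMap, hι]
      simp [ψ]
    rw [this]
    exact Algebra.subset_adjoin ⟨i, rfl⟩
  · have : ψ (splitMap F c a b (.inr (.inl k))) = 0 := by
      simp [splitMap, hι]
      simp [ψ]
    rw [this]
    exact zero_mem _
  · have : ψ (splitMap F c a b (.inr (.inr k))) = 0 := by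
      simp [splitMap, hι]
      simp [ψ]
    rw [this]
    exact zero_mem _

theorem exists_eq_add_of_degree {m : σ →₀ ℕ} {d : ℕ} (e : ℕ) (hm : m.degree = d + e) :
    ∃ a b : σ →₀ ℕ, m = a + b ∧ a.degree = d ∧ b.degree = e := by
  induction d generalizing e with
  | zero => exact ⟨0, m, by simp, by simp, by simpa using hm⟩
  | succ d ih =>
    obtain ⟨a, b, rfl, ha, hb⟩ := ih (e + 1) (by omega)
    have : b ≠ 0 := by rintro rfl; simp at hb
    obtain ⟨i, hi⟩ := Finsupp.ne_iff.1 this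
    have hle : Finsupp.single i 1 ≤ b := by
      simpa [Nat.one_le_iff_ne_zero] using hi
    obtain ⟨b', rfl⟩ := exists_add_of_le hle
    refine ⟨a + Finsupp.single i 1, b', by rw [add_assoc], by simp [ha], ?_⟩
    simp only [map_add, Finsupp.degree_single] at hb
    omega

theorem totalDegree_splitMap_le {F : σ → MvPolynomial σ ℂ} {c : σ → κ → ℂ}
    {a b : κ → MvPolynomial σ ℂ} {d : ℕ} (ha : ∀ k, (a k).totalDegree ≤ 2)
    (hb : ∀ k, (b k).totalDegree ≤ d)
    (hF : ∀ i, (F i - ∑ k, C (c i k) * (a k * b k)).totalDegree ≤ d + 1) (hd : 2 ≤ d)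
    (i : σ ⊕ (κ ⊕ κ)) : (splitMap F c a b i).totalDegree ≤ d + 1 := by
  have hX : ∀ k : σ ⊕ (κ ⊕ κ), (X k : MvPolynomial (σ ⊕ (κ ⊕ κ)) ℂ).totalDegree ≤ 1 :=
    fun k => (totalDegree_X k).le
  have ha' : ∀ k, (rename (Sum.inl : σ → σ ⊕ (κ ⊕ κ)) (a k)).totalDegree ≤ 2 :=
    fun k => (totalDegree_rename_le _ _).trans (ha k)
  have hb' : ∀ k, (rename (Sum.inl : σ → σ ⊕ (κ ⊕ κ)) (b k)).totalDegree ≤ d :=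
    fun k => (totalDegree_rename_le _ _).trans (hb k)
  rcases i with i | k | k
  · have : splitMap F c a b (.inl i) =
        rename Sum.inl (F i - ∑ k, C (c i k) * (a k * b k)) -
        ∑ k, C (c i k) * (X (.inr (.inl k)) * X (.inr (.inr k)) +
          X (.inr (.inl k)) * rename Sum.inl (b k) + rename Sum.inl (a k) * X (.inr (.inr k))) := by
      simp only [splitMap, Sum.elim_inl, map_sub, map_sum, map_mul, rename_C, sub_sub,
        ← Finset.sum_add_distrib]
      congr 1
      exact Finset.sum_congr rfl fun k _ => by ring
    rw [this]
    refine (totalDegree_sub _ _).trans (max_le ((totalDegree_rename_le _ _).trans (hF i)) ?_)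
    refine totalDegree_finsetSum_le fun k _ => ?_
    refine (totalDegree_mul _ _).trans ?_
    rw [totalDegree_C, zero_add]
    refine (totalDegree_add _ _).trans (max_le ((totalDegree_add _ _).trans (max_le ?_ ?_)) ?_) <;>
      refine (totalDegree_mul _ _).trans ?_
    · have := hX (.inr (.inl k)); have := hX (.inr (.inr k)); omega
    · have := hX (.inr (.inl k)); have := hb' k; omega
    · have := ha' k; have := hX (.inr (.inr k)); omega
  · refine (totalDegree_add _ _).trans (max_le ?_ ?_)
    · have := hX (.inr (.inl k)); omega
    · have := ha' k; omega
  · refine (totalDegree_add _ _).trans (max_le ?_ ?_)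
    · have := hX (.inr (.inr k)); omega
    · have := hb' k; omega

/-- Each top-degree monomial is factored into monomials of degrees 2 and `d`, with one pair of new
variables. Expanding `(Y + a)(Z + b)` shows that subtracting it cancels `ab` and leaves terms of
degrees 2, 3 and `d + 1` at most; `2 ≤ d` keeps all of them within `d + 1`. -/
theorem BoundedDegreeConjecture.succ {d : ℕ} (hd : 2 ≤ d) (h : BoundedDegreeConjecture (d + 1)) :
    BoundedDegreeConjecture (d + 2) := by
  intro σ _ _ F hF hdet
  let S : Finset (σ →₀ ℕ) :=
    (Finset.univ.biUnion fun i => (F i).support).filter fun m => m.degree = 2 + d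
  have hS : ∀ k : S, ∃ a b : σ →₀ ℕ, k.1 = a + b ∧ a.degree = 2 ∧ b.degree = d :=
    fun k => exists_eq_add_of_degree d (Finset.mem_filter.1 k.2).2
  choose a b hab ha hb using hS
  refine generates_of_splitMap (c := fun i k => coeff k.1 (F i)) (a := fun k => monomial (a k) 1)
    (b := fun k => monomial (b k) 1) (h _ _ (totalDegree_splitMap_le ?_ ?_ ?_ hd) ?_)
  · exact fun k => (totalDegree_monomial_le _ _).trans (ha k).le
  · exact fun k => (totalDegree_monomial_le _ _).trans (hb k).le
  · intro i
    have hsum : ∑ k : S, C (coeff k.1 (F i)) * (monomial (a k) (1 : ℂ) * monomial (b k) 1) =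
        ∑ m ∈ S, monomial m (coeff m (F i)) := by
      rw [← Finset.sum_coe_sort S]
      refine Finset.sum_congr rfl fun k _ => ?_
      rw [monomial_mul, ← hab, C_mul_monomial, mul_one, mul_one]
    rw [hsum]
    refine Finset.sup_le fun m hm => ?_
    rw [mem_support_iff, coeff_sub, coeff_sum] at hm
    simp only [coeff_monomial, Finset.sum_ite_eq'] at hm
    have hmS : m ∉ S := fun hmS => by simp [hmS] at hm
    simp only [hmS, if_false, sub_zero] at hm
    have hle : m.degree ≤ d + 2 := (le_totalDegree (mem_support_iff.2 hm)).trans (hF i)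
    have hne : m.degree ≠ 2 + d := fun hmd => hmS (Finset.mem_filter.2
      ⟨Finset.mem_biUnion.2 ⟨i, Finset.mem_univ _, mem_support_iff.2 hm⟩, hmd⟩)
    change m.degree ≤ _
    omega
  · rw [det_jac_splitMap, hdet, map_one]

theorem BoundedDegreeConjecture.of_three (h : BoundedDegreeConjecture 3) (D : ℕ) :
    BoundedDegreeConjecture (D + 3) := by
  induction D with
  | zero => exact h
  | succ D ih => exact ih.succ (d := D + 2) (by omega)

end DegreeReduction

/-! ### Reduction to a cubic homogeneous nonlinear part -/

section Homogenization

variable {σ : Type}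

/-- The cubic homogeneous map `(T A - T² Y, B, 0)` for `A` quadratic and `B` cubic. -/
def homogenizedMap (A B : σ → MvPolynomial σ ℂ) :
    (σ ⊕ σ) ⊕ Unit → MvPolynomial ((σ ⊕ σ) ⊕ Unit) ℂ :=
  Sum.elim (Sum.elim
    (fun i => X (.inr ()) * rename Sum.inl (rename Sum.inl (A i)) -
      X (.inr ()) ^ 2 * X (.inl (.inr i)))
    (fun i => rename Sum.inl (rename Sum.inl (B i)))) 0

/-- The Schur complement is `1 + T A' + T² B'`, with `A'` and `B'` the Jacobian matrices. Since
their entries have degrees 1 and 2, this is `1 + A' + B'` evaluated at `T x`. -/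
theorem det_one_add_jac_homogenizedMap [Fintype σ] [DecidableEq σ] {A B : σ → MvPolynomial σ ℂ}
    (hA : ∀ i, (A i).IsHomogeneous 2) (hB : ∀ i, (B i).IsHomogeneous 3)
    (hdet : (1 + jac A + jac B).det = 1) : (1 + jac (homogenizedMap A B)).det = 1 := by
  let ι : MvPolynomial σ ℂ →ₐ[ℂ] MvPolynomial ((σ ⊕ σ) ⊕ Unit) ℂ :=
    (rename Sum.inl).comp (rename Sum.inl)
  let T : MvPolynomial ((σ ⊕ σ) ⊕ Unit) ℂ := X (.inr ())
  have hblock : 1 + jac (homogenizedMap A B) = Matrix.fromBlocks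
      (Matrix.fromBlocks (1 + T • (jac A).map ι) (-(T ^ 2 • 1)) ((jac B).map ι) 1)
      (Matrix.of fun i j => jac (homogenizedMap A B) (.inl i) (.inr j)) 0 1 := by
    refine Matrix.ext fun i j => ?_
    rcases i with (i | i) | i <;> rcases j with (j | j) | j <;>
      simp [homogenizedMap, pderiv_inl_rename_inl, pderiv_inr_rename_inl, pderiv_X, Pi.single_apply,
        Matrix.one_apply, T, ι, eq_comm, -rename_rename]
  rw [hblock, Matrix.det_fromBlocks_zero₂₁, Matrix.det_one, mul_one, Matrix.det_fromBlocks_one₂₂]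
  let θ : MvPolynomial σ ℂ →ₐ[ℂ] MvPolynomial ((σ ⊕ σ) ⊕ Unit) ℂ := aeval fun i => T * ι (X i)
  have hθ : ∀ {d : ℕ} {p : MvPolynomial σ ℂ}, p.IsHomogeneous d → θ p = T ^ d * ι p := by
    intro d p hp
    rw [show θ p = _ from aeval_mul_of_isHomogeneous hp _ _]
    congr 1
    have : (aeval fun i => ι (X i)) = ι := by ext1 i; simp
    rw [this]
  have h := congrArg θ hdet
  rw [map_one, AlgHom.map_det] at h
  rw [← h]
  congr 1
  ext1 i j
  have h1 := hθ ((hA i).pderiv (i := j))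
  have h2 := hθ ((hB i).pderiv (i := j))
  norm_num at h1 h2
  by_cases hij : i = j
  · subst hij; simp [h1, h2]
  · simp [h1, h2, hij]

theorem isHomogeneous_homogenizedMap {A B : σ → MvPolynomial σ ℂ}
    (hA : ∀ i, (A i).IsHomogeneous 2) (hB : ∀ i, (B i).IsHomogeneous 3)
    (i : (σ ⊕ σ) ⊕ Unit) : (homogenizedMap A B i).IsHomogeneous 3 := by
  rcases i with (i | i) | i
  · exact ((isHomogeneous_X ℂ _).mul (hA i).rename_isHomogeneous.rename_isHomogeneous).sub
      (((isHomogeneous_X ℂ _).pow 2).mul (isHomogeneous_X ℂ _))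
  · exact (hB i).rename_isHomogeneous.rename_isHomogeneous
  · exact isHomogeneous_zero _ _ _

/-- On `y = -B(x)`, `t = 1` the map `(x + tA - t²y, y + B, t)` becomes `(x + A + B, 0, 1)`. -/
theorem CubicHomogeneousConjecture.generates_of_normalized [Fintype σ] [DecidableEq σ]
    (h : CubicHomogeneousConjecture)
    {A B : σ → MvPolynomial σ ℂ}
    (hA : ∀ i, (A i).IsHomogeneous 2) (hB : ∀ i, (B i).IsHomogeneous 3)
    (hdet : (1 + jac A + jac B).det = 1) : Generates fun i => X i + A i + B i := by
  have hK := h _ (homogenizedMap A B) (isHomogeneous_homogenizedMap hA hB)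
    (det_one_add_jac_homogenizedMap hA hB hdet)
  let ψ : MvPolynomial ((σ ⊕ σ) ⊕ Unit) ℂ →ₐ[ℂ] MvPolynomial σ ℂ :=
    aeval (Sum.elim (Sum.elim X fun i => - B i) 1)
  have hι : ∀ p, ψ (rename Sum.inl (rename Sum.inl p)) = p := fun p => by
    change aeval _ (rename Sum.inl (rename Sum.inl p)) = p
    rw [aeval_rename, aeval_rename]
    exact aeval_X_left_apply p
  refine hK.of_surjective ψ (fun p => ⟨_, hι p⟩) fun k => ?_
  rcases k with (i | i) | i
  · have : ψ (X (.inl (.inl i)) + homogenizedMap A B (.inl (.inl i))) = X i + A i + B i := by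
      simp [homogenizedMap, hι, -rename_rename]
      simp [ψ, add_assoc]
    rw [this]
    exact Algebra.subset_adjoin ⟨i, rfl⟩
  · have : ψ (X (.inl (.inr i)) + homogenizedMap A B (.inl (.inr i))) = 0 := by
      simp [homogenizedMap, hι, -rename_rename]
      simp [ψ]
    rw [this]
    exact zero_mem _
  · have : ψ (X (.inr i) + homogenizedMap A B (.inr i)) = 1 := by
      simp [homogenizedMap]
      simp [ψ]
    rw [this]
    exact one_mem _

/-- Euler's identity, with the derivatives of a linear form being constants. -/
theorem homogeneousComponent_one_eq_sum [Fintype σ] (p : MvPolynomial σ ℂ) :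
    homogeneousComponent 1 p = ∑ k, C (constantCoeff (pderiv k p)) * X k := by
  have hp : (homogeneousComponent 1 p).IsHomogeneous 1 := homogeneousComponent_isHomogeneous 1 p
  have h := hp.sum_X_mul_pderiv
  rw [one_smul] at h
  rw [← h]
  refine Finset.sum_congr rfl fun k _ => ?_
  have h0 : (pderiv k (homogeneousComponent 1 p)).IsHomogeneous 0 := hp.pderiv
  rw [← totalDegree_zero_iff_isHomogeneous, totalDegree_eq_zero_iff_eq_C] at h0
  rw [h0, mul_comm]
  congr 2
  simp [constantCoeff_eq, coeff_pderiv, coeff_homogeneousComponent]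

/-- Subtracting `F(0)` and multiplying by the inverse of the Jacobian matrix at the origin, which
has determinant 1, brings `F` to the form `X + A + B`. This affine change affects neither the
determinant nor the generated algebra. -/
theorem CubicHomogeneousConjecture.boundedDegreeConjecture_three
    (h : CubicHomogeneousConjecture) : BoundedDegreeConjecture 3 := by
  intro σ _ _ F hF hdet
  let L : Matrix σ σ ℂ := constantCoeff.mapMatrix (jac F)
  have hL : L.det = 1 := by
    rw [← RingHom.map_det, hdet, map_one]
  have hLu : IsUnit L.det := by rw [hL]; exact isUnit_one
  let M := L⁻¹
  have hM : M.det = 1 := by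
    rw [Matrix.det_nonsing_inv, hL, Ring.inverse_one]
  let A : σ → MvPolynomial σ ℂ := fun i => ∑ j, C (M i j) * homogeneousComponent 2 (F j)
  let B : σ → MvPolynomial σ ℂ := fun i => ∑ j, C (M i j) * homogeneousComponent 3 (F j)
  have hA : ∀ i, (A i).IsHomogeneous 2 := fun i => IsHomogeneous.sum _ _ _ fun j _ =>
    (homogeneousComponent_isHomogeneous 2 (F j)).C_mul _
  have hB : ∀ i, (B i).IsHomogeneous 3 := fun i => IsHomogeneous.sum _ _ _ fun j _ =>
    (homogeneousComponent_isHomogeneous 3 (F j)).C_mul _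
  have hF' : ∀ j, F j = C (coeff 0 (F j)) + ∑ k, C (L j k) * X k +
      homogeneousComponent 2 (F j) + homogeneousComponent 3 (F j) := by
    intro j
    have h4 : ∑ i ∈ Finset.range 4, homogeneousComponent i (F j) = F j := by
      conv_rhs => rw [← sum_homogeneousComponent (F j)]
      symm
      refine Finset.sum_subset (fun i hi => ?_) fun i _ hi => homogeneousComponent_eq_zero _ _ ?_
      · have := hF j
        simp only [Finset.mem_range] at hi ⊢
        omega
      · simpa using hi
    conv_lhs => rw [← h4]
    rw [Finset.sum_range_succ, Finset.sum_range_succ, Finset.sum_range_succ,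
      Finset.sum_range_one, homogeneousComponent_zero, homogeneousComponent_one_eq_sum]
    rfl
  have hG : ∀ i, X i + A i + B i = ∑ j, C (M i j) * (F j - C (coeff 0 (F j))) := by
    intro i
    have h1 : ∑ j, C (M i j) * ∑ k, C (L j k) * X k = (X i : MvPolynomial σ ℂ) := by
      simp only [Finset.mul_sum]
      rw [Finset.sum_comm]
      have : ∀ k, ∑ j, C (M i j) * (C (L j k) * X k) =
          (C ((1 : Matrix σ σ ℂ) i k) * X k : MvPolynomial σ ℂ) := by
        intro k
        rw [← Matrix.nonsing_inv_mul L hLu, Matrix.mul_apply, map_sum, Finset.sum_mul]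
        exact Finset.sum_congr rfl fun j _ => by rw [map_mul, mul_assoc]
      simp only [this]
      rw [Finset.sum_eq_single i] <;> simp +contextual [eq_comm]
    rw [← h1, ← Finset.sum_add_distrib, ← Finset.sum_add_distrib]
    refine Finset.sum_congr rfl fun j _ => ?_
    linear_combination -C (M i j) * hF' j
  have hdet' : (1 + jac A + jac B).det = 1 := by
    have : 1 + jac A + jac B = C.mapMatrix M * jac F := by
      rw [← jac_X, ← jac_add, ← jac_add]
      ext1 i j
      rw [jac_apply, hG]
      simp [Matrix.mul_apply]
    rw [this, Matrix.det_mul, hdet, mul_one, ← RingHom.map_det, hM, map_one]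
  refine (h.generates_of_normalized hA hB hdet').of_surjective (AlgHom.id ℂ _)
    Function.surjective_id fun i => ?_
  rw [AlgHom.id_apply, hG]
  refine Subalgebra.sum_mem _ fun j _ => Subalgebra.mul_mem _ (Subalgebra.algebraMap_mem _ _)
    (Subalgebra.sub_mem _ (Algebra.subset_adjoin ⟨j, rfl⟩) (Subalgebra.algebraMap_mem _ _))

end Homogenization

theorem CubicHomogeneousConjecture.generates {σ : Type} [Fintype σ] [DecidableEq σ]
    (h : CubicHomogeneousConjecture) {F : σ → MvPolynomial σ ℂ} (hdet : (jac F).det = 1) :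
    Generates F := by
  refine h.boundedDegreeConjecture_three.of_three (∑ i, (F i).totalDegree) σ F (fun i => ?_) hdet
  exact (Finset.single_le_sum (fun i _ => Nat.zero_le (F i).totalDegree)
    (Finset.mem_univ i)).trans (Nat.le_add_right _ _)

/-! ### Reduction to gradient maps -/

/-- Invertibility of the polynomial maps `X - ∇P` for `P` quartic homogeneous with nilpotent
Hessian. -/
def QuarticGradientConjecture : Prop :=
  ∀ (σ : Type) [Fintype σ] [Nonempty σ] [DecidableEq σ] (P : MvPolynomial σ ℂ), P.IsHomogeneous 4 →
    IsNilpotent (jac fun i => pderiv i P) → Generates fun i => X i - pderiv i P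

theorem isNilpotent_fromBlocks_zero₁₂ {R m n : Type*} [CommRing R] [Fintype m] [Fintype n]
    [DecidableEq m] [DecidableEq n] {A : Matrix m m R} (C : Matrix n m R) {D : Matrix n n R}
    (hA : IsNilpotent A) (hD : IsNilpotent D) : IsNilpotent (Matrix.fromBlocks A 0 C D) := by
  have hpow : ∀ k : ℕ, ∃ C', Matrix.fromBlocks A 0 C D ^ k =
      Matrix.fromBlocks (A ^ k) 0 C' (D ^ k) := by
    intro k
    induction k with
    | zero => exact ⟨0, by simp⟩
    | succ k ih =>
      obtain ⟨C', hC'⟩ := ih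
      exact ⟨C' * A + D ^ k * C, by rw [pow_succ, hC', Matrix.fromBlocks_multiply]; simp [pow_succ]⟩
  obtain ⟨a, ha⟩ := hA
  obtain ⟨d, hd⟩ := hD
  obtain ⟨C', hC'⟩ := hpow (a + d)
  rw [pow_add A, pow_add D, ha, hd, zero_mul, mul_zero] at hC'
  refine ⟨(a + d) * 2, ?_⟩
  rw [pow_mul, hC', sq, Matrix.fromBlocks_multiply]
  simp

theorem isNilpotent_of_mul_eq_mul {A : Type*} [Ring A] {N T c c' : A} (hT : IsNilpotent T)
    (hc : c' * c = 1) (h : c * N = T * c) : IsNilpotent N := by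
  obtain ⟨k, hk⟩ := hT
  have hpow : c * N ^ k = T ^ k * c := ((show SemiconjBy c N T from h).pow_right k)
  refine ⟨k, ?_⟩
  rw [← one_mul (N ^ k), ← hc, mul_assoc, hpow, hk, zero_mul, mul_zero]

section Symmetrization

variable {σ : Type}

/-- The complex coordinates `u = x + i y`. -/
def isotropicU (j : σ) : MvPolynomial (σ ⊕ σ) ℂ := X (.inl j) + C Complex.I * X (.inr j)

/-- The complex coordinates `v = x - i y`. -/
def isotropicV (j : σ) : MvPolynomial (σ ⊕ σ) ℂ := X (.inl j) - C Complex.I * X (.inr j)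

theorem pderiv_inl_isotropicV [DecidableEq σ] (i j : σ) :
    pderiv (.inl i) (isotropicV j) = if i = j then 1 else 0 := by
  simp [isotropicV, pderiv_X, Pi.single_apply, eq_comm]

theorem pderiv_inr_isotropicV [DecidableEq σ] (i j : σ) :
    pderiv (.inr i) (isotropicV j) = if i = j then - C Complex.I else 0 := by
  by_cases h : i = j
  · subst h; simp [isotropicV]
  · simp [isotropicV, pderiv_X, h, Ne.symm h]

variable [Fintype σ]

/-- The polynomial `-½ ∑ v_j H_j(u)` in `x` and `y`, where `u = x + i y` and `v = x - i y`. -/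
def symmetrization (H : σ → MvPolynomial σ ℂ) : MvPolynomial (σ ⊕ σ) ℂ :=
  C (-1 / 2) * ∑ j, isotropicV j * aeval isotropicU (H j)

theorem isHomogeneous_symmetrization {H : σ → MvPolynomial σ ℂ} {d : ℕ}
    (hH : ∀ i, (H i).IsHomogeneous d) : (symmetrization H).IsHomogeneous (d + 1) := by
  refine IsHomogeneous.C_mul (IsHomogeneous.sum _ _ _ fun j _ => ?_) _
  rw [add_comm]
  refine IsHomogeneous.mul ((isHomogeneous_X ℂ _).sub ((isHomogeneous_X ℂ _).C_mul _)) ?_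
  have := (hH j).aeval (isotropicU : σ → MvPolynomial (σ ⊕ σ) ℂ) (n := 1)
    fun i => (isHomogeneous_X ℂ _).add ((isHomogeneous_X ℂ _).C_mul _)
  rwa [one_mul] at this

variable [DecidableEq σ]

theorem pderiv_inl_aeval_isotropicU (j : σ) (p : MvPolynomial σ ℂ) :
    pderiv (.inl j) (aeval isotropicU p) = aeval isotropicU (pderiv j p) := by
  rw [derivation_aeval, Finset.sum_eq_single j] <;>
    simp +contextual [isotropicU, pderiv_X, -aeval_eq_bind₁]

theorem pderiv_inr_aeval_isotropicU (j : σ) (p : MvPolynomial σ ℂ) :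
    pderiv (.inr j) (aeval isotropicU p) = C Complex.I * aeval isotropicU (pderiv j p) := by
  rw [derivation_aeval, Finset.sum_eq_single j] <;>
    simp +contextual [isotropicU, pderiv_X, -aeval_eq_bind₁, mul_comm]

theorem pderiv_inl_symmetrization (H : σ → MvPolynomial σ ℂ) (j : σ) :
    pderiv (.inl j) (symmetrization H) = C (-1 / 2) * (aeval isotropicU (H j) +
      ∑ k, isotropicV k * aeval isotropicU (pderiv j (H k))) := by
  simp [symmetrization, pderiv_inl_aeval_isotropicU, pderiv_inl_isotropicV, -aeval_eq_bind₁,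
    Finset.sum_add_distrib, add_comm]

theorem pderiv_inr_symmetrization (H : σ → MvPolynomial σ ℂ) (j : σ) :
    pderiv (.inr j) (symmetrization H) = C (-1 / 2) * C Complex.I * (- aeval isotropicU (H j) +
      ∑ k, isotropicV k * aeval isotropicU (pderiv j (H k))) := by
  simp [symmetrization, pderiv_inr_aeval_isotropicU, pderiv_inr_isotropicV, -aeval_eq_bind₁,
    Finset.sum_add_distrib, mul_left_comm _ (C Complex.I), ← Finset.mul_sum]
  ring

/-- In the coordinates `u = x + iy`, `v = x - iy`, the gradient of `P` has the components `P_x +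
iP_y = 2P_v = -H(u)` and `P_x - iP_y = 2P_u = -∑ v_k ∇H_k(u)`. Its Jacobian matrix is thus block
triangular, with diagonal blocks `-A` and `-Aᵀ` for `A` the matrix `jac H` at `u`. -/
theorem isNilpotent_jac_gradient_symmetrization {H : σ → MvPolynomial σ ℂ}
    (hH : IsNilpotent (jac H)) :
    IsNilpotent (jac fun i => pderiv i (symmetrization H)) := by
  let α : MvPolynomial σ ℂ →ₐ[ℂ] MvPolynomial (σ ⊕ σ) ℂ := aeval isotropicU
  let I : MvPolynomial (σ ⊕ σ) ℂ := C Complex.I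
  let h : MvPolynomial (σ ⊕ σ) ℂ := C (-1 / 2)
  have hI : I * I = -1 := by simp [I, ← C_mul]
  have hh : h + h = -1 := by simp only [h, ← C_add]; norm_num
  let A : Matrix σ σ (MvPolynomial (σ ⊕ σ) ℂ) := (jac H).map α
  let S : Matrix σ σ (MvPolynomial (σ ⊕ σ) ℂ) :=
    Matrix.of fun j k => ∑ l, isotropicV l * α (pderiv k (pderiv j (H l)))
  have hA : IsNilpotent A := hH.map α.mapMatrix
  have hAT : IsNilpotent A.transpose := by
    obtain ⟨k, hk⟩ := hA
    exact ⟨k, by rw [← Matrix.transpose_pow, hk, Matrix.transpose_zero]⟩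
  have hess : (jac fun i => pderiv i (symmetrization H)) = Matrix.fromBlocks
      (h • (A + A.transpose + S)) ((h * I) • (A - A.transpose + S))
      ((h * I) • (-A + A.transpose + S)) (h • (A + A.transpose - S)) := by
    have e1 : ∀ i j, A i j = aeval isotropicU (pderiv j (H i)) := fun _ _ => rfl
    have e2 : ∀ i j, S i j =
      ∑ l, isotropicV l * aeval isotropicU (pderiv j (pderiv i (H l))) := fun _ _ => rfl
    have hI2 : C Complex.I * C Complex.I = (-1 : MvPolynomial (σ ⊕ σ) ℂ) := hI
    refine Matrix.ext fun i j => ?_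
    rcases i with i | i <;> rcases j with j | j <;>
      simp only [jac_apply, pderiv_inl_symmetrization, pderiv_inr_symmetrization, map_add, map_sum,
        pderiv_mul, pderiv_inl_aeval_isotropicU, pderiv_inr_aeval_isotropicU, pderiv_inl_isotropicV,
        pderiv_inr_isotropicV, pderiv_C, map_neg, Matrix.fromBlocks_apply₁₁,
        Matrix.fromBlocks_apply₁₂, Matrix.fromBlocks_apply₂₁, Matrix.fromBlocks_apply₂₂,
        Matrix.smul_apply, Matrix.add_apply, Matrix.sub_apply, Matrix.neg_apply,
        Matrix.transpose_apply, smul_eq_mul, e1, e2, Finset.sum_add_distrib, ite_mul, one_mul,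
        zero_mul, zero_add, Finset.sum_ite_eq, Finset.mem_univ, if_true,
        mul_left_comm _ (C Complex.I), ← Finset.mul_sum]
    · ring
    · ring
    · ring
    · linear_combination C (-1 / 2) * (-aeval isotropicU (pderiv j (H i)) -
        aeval isotropicU (pderiv i (H j)) +
        ∑ l, isotropicV l * aeval isotropicU (pderiv j (pderiv i (H l)))) * hI2
  -- `c` is the change of coordinates from `(x, y)` to `(u, v)` and `c'` is its inverse, as `h =
  -- -1/2`.
  refine isNilpotent_of_mul_eq_mul (T := Matrix.fromBlocks (-A) 0 (-S) (-A.transpose))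
    (c := Matrix.fromBlocks 1 (I • 1) 1 (-I • 1))
    (c' := Matrix.fromBlocks (-h • 1) (-h • 1) ((h * I) • 1) (-(h * I) • 1))
    (isNilpotent_fromBlocks_zero₁₂ _ hA.neg hAT.neg) ?_ ?_
  · rw [Matrix.fromBlocks_multiply, ← Matrix.fromBlocks_one, Matrix.fromBlocks_inj]
    refine ⟨?_, ?_, ?_, ?_⟩ <;> ext1 i j <;>
      simp only [Matrix.mul_smul, Matrix.mul_one, Matrix.add_apply, Matrix.smul_apply,
        smul_eq_mul, Matrix.zero_apply]
    · linear_combination -(1 : Matrix σ σ (MvPolynomial (σ ⊕ σ) ℂ)) i j * hh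
    · ring
    · ring
    · linear_combination (1 : Matrix σ σ (MvPolynomial (σ ⊕ σ) ℂ)) i j * (2 * h * hI - hh)
  · rw [hess, Matrix.fromBlocks_multiply, Matrix.fromBlocks_multiply, Matrix.fromBlocks_inj]
    refine ⟨?_, ?_, ?_, ?_⟩ <;> ext1 i j <;>
      simp only [Matrix.smul_mul, Matrix.mul_one, Matrix.one_mul, Matrix.mul_smul,
        Matrix.add_apply, Matrix.sub_apply, Matrix.neg_apply, Matrix.smul_apply,
        smul_eq_mul, Matrix.zero_apply]
    · linear_combination h * (-A i j + A.transpose i j + S i j) * hI + A i j * hh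
    · linear_combination I * A i j * hh
    · linear_combination h * (A i j - A.transpose i j - S i j) * hI +
        (A.transpose i j + S i j) * hh
    · linear_combination I * (S i j - A.transpose i j) * hh

end Symmetrization

theorem QuarticGradientConjecture.cubicHomogeneousConjecture (h : QuarticGradientConjecture) :
    CubicHomogeneousConjecture := by
  intro σ _ _ H hH hdet
  cases isEmpty_or_nonempty σ with
  | inl _ => exact generates_of_forall_X fun i => isEmptyElim i
  | inr _ =>
  have hP := h (σ ⊕ σ) (symmetrization H) (isHomogeneous_symmetrization hH)
    (isNilpotent_jac_gradient_symmetrization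
      (isNilpotent_jac_of_det_one_add two_ne_zero hH hdet))
  -- Restriction to the subspace `v = 0`, parametrized by `u` through `x = u/2`, `y = -iu/2`. There
  -- the map is `u ↦ u + H(u)` in the same parametrization.
  let ψ : MvPolynomial (σ ⊕ σ) ℂ →ₐ[ℂ] MvPolynomial σ ℂ :=
    aeval (Sum.elim (fun i => C (1 / 2) * X i) fun i => C (-Complex.I / 2) * X i)
  have hC : ∀ a, ψ (C a) = C a := fun a => ψ.commutes a
  have hxl : ∀ i, ψ (X (.inl i)) = C (1 / 2) * X i := fun i => by simp [ψ]
  have hxr : ∀ i, ψ (X (.inr i)) = C (-Complex.I / 2) * X i := fun i => by simp [ψ]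
  have hU : ∀ i, ψ (isotropicU i) = X i := by
    intro i
    have e : (C (1 / 2) + C Complex.I * C (-Complex.I / 2) : MvPolynomial σ ℂ) = 1 := by
      rw [← C_mul, ← C_add, ← C_1]
      congr 1
      linear_combination -Complex.I_mul_I / 2
    rw [isotropicU, map_add, map_mul, hxl, hxr, hC]
    linear_combination X i * e
  have hV : ∀ i, ψ (isotropicV i) = 0 := by
    intro i
    have e : (C (1 / 2) - C Complex.I * C (-Complex.I / 2) : MvPolynomial σ ℂ) = 0 := by
      rw [← C_mul, ← C_sub, ← C_0]
      congr 1
      linear_combination Complex.I_mul_I / 2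
    rw [isotropicV, map_sub, map_mul, hxl, hxr, hC]
    linear_combination X i * e
  have hα : ∀ p, ψ (aeval isotropicU p) = p := by
    intro p
    have : ψ.comp (aeval isotropicU) = AlgHom.id ℂ (MvPolynomial σ ℂ) := by
      ext1 i
      rw [AlgHom.comp_apply, aeval_X, hU, AlgHom.id_apply]
    exact DFunLike.congr_fun this p
  refine hP.of_surjective ψ (fun p => ⟨_, hα p⟩) fun k => ?_
  have hmem : ∀ (a : ℂ) (i : σ), C a * (X i + H i) ∈
      Algebra.adjoin ℂ (Set.range fun i => X i + H i) := fun a i =>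
    Subalgebra.mul_mem _ (Subalgebra.algebraMap_mem _ _) (Algebra.subset_adjoin ⟨i, rfl⟩)
  rcases k with i | i
  · have : ψ (X (.inl i) - pderiv (.inl i) (symmetrization H)) = C (1 / 2) * (X i + H i) := by
      have e : (C (1 / 2) + C (-1 / 2) : MvPolynomial σ ℂ) = 0 := by
        rw [← C_add]; norm_num
      rw [pderiv_inl_symmetrization, map_sub, map_mul, map_add, map_sum, hxl, hC, hα]
      simp only [map_mul, hV, zero_mul, Finset.sum_const_zero]
      linear_combination -H i * e
    rw [this]
    exact hmem _ i
  · have : ψ (X (.inr i) - pderiv (.inr i) (symmetrization H)) =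
        C (-Complex.I / 2) * (X i + H i) := by
      have e : (C (-1 / 2) * C Complex.I : MvPolynomial σ ℂ) = C (-Complex.I / 2) := by
        rw [← C_mul]
        congr 1
        ring
      rw [pderiv_inr_symmetrization, map_sub, map_mul, map_mul, map_add, map_neg, map_sum, hxr, hC,
        hC, hα, e]
      simp only [map_mul, hV, zero_mul, Finset.sum_const_zero]
      ring
    rw [this]
    exact hmem _ i

/-! ### Existence and uniqueness of the power series solution -/

section ExistsUnique

variable {n : ℕ}

/-- The integral form of the Cauchy problem: `V ↦ P + ∫₀ᵗ ½⟨∇V, ∇V⟩`. -/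
def cauchyStep (P : MvPolynomial (Fin n) ℂ) (V : SeriesZT n) : SeriesZT n := fun m =>
  if m none = 0 then coeff m.some P
  else (m none : ℂ)⁻¹ * MvPowerSeries.coeff (m - Finsupp.single none 1)
    ((1 / 2 : ℂ) • (gradientZ V ⬝ᵥ gradientZ V))

theorem coeff_cauchyStep (P : MvPolynomial (Fin n) ℂ) (V : SeriesZT n) (m : Option (Fin n) →₀ ℕ) :
    MvPowerSeries.coeff m (cauchyStep P V) = if m none = 0 then coeff m.some P
      else (m none : ℂ)⁻¹ * MvPowerSeries.coeff (m - Finsupp.single none 1)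
        ((1 / 2 : ℂ) • (gradientZ V ⬝ᵥ gradientZ V)) := rfl

theorem mapDomain_some_of_none_eq_zero {α : Type*} {m : Option α →₀ ℕ} (hm : m none = 0) :
    m.some.mapDomain some = m := by
  ext o
  cases o with
  | none => rw [Finsupp.mapDomain_of_notMem_range _ _ (by simp), hm]
  | some a => rw [Finsupp.mapDomain_apply (Option.some_injective _), Finsupp.some_apply]

theorem some_mapDomain_some {α : Type*} (m : α →₀ ℕ) : (m.mapDomain some).some = m := by
  ext a
  rw [Finsupp.some_apply, Finsupp.mapDomain_apply (Option.some_injective _)]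

theorem mapDomain_some_none {α : Type*} (m : α →₀ ℕ) : m.mapDomain some none = 0 :=
  Finsupp.mapDomain_of_notMem_range _ _ (by simp)

theorem exists_eq_add_single_none {α : Type*} {m : Option α →₀ ℕ} (hm : m none ≠ 0) :
    ∃ m', m = m' + Finsupp.single none 1 := by
  have hle : Finsupp.single none 1 ≤ m := by
    simpa [Nat.one_le_iff_ne_zero] using hm
  exact ⟨_, (tsub_add_cancel_of_le hle).symm⟩

/-- Coefficientwise, `∂/∂t` multiplies by the exponent of `t`, which is nonzero in `ℂ` away from
`t⁰`; the `t⁰` coefficients are the initial condition. -/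
theorem isCauchySolution_iff {P : MvPolynomial (Fin n) ℂ} {U : SeriesZT n} :
    IsCauchySolution P U ↔ cauchyStep P U = U := by
  constructor
  · rintro ⟨heq, hinit⟩
    ext m
    rw [coeff_cauchyStep]
    split_ifs with hm
    · have := congrArg (MvPowerSeries.coeff m.some) hinit
      rw [MvPolynomial.coeff_coe] at this
      rw [← this]
      change MvPowerSeries.coeff (m.some.mapDomain some) U = _
      rw [mapDomain_some_of_none_eq_zero hm]
    · obtain ⟨m', rfl⟩ := exists_eq_add_single_none hm
      rw [add_tsub_cancel_right, ← heq, MvPowerSeries.coeff_pderiv]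
      have : ((m' none : ℂ) + 1) ≠ 0 := Nat.cast_add_one_ne_zero _
      simp
      field_simp
  · intro h
    constructor
    · ext m
      have hm := congrArg (MvPowerSeries.coeff (m + Finsupp.single none 1)) h
      rw [coeff_cauchyStep, if_neg (by simp), add_tsub_cancel_right] at hm
      rw [MvPowerSeries.coeff_pderiv, ← hm]
      have : ((m none : ℂ) + 1) ≠ 0 := Nat.cast_add_one_ne_zero _
      simp
      field_simp
    · ext m
      have hm := congrArg (MvPowerSeries.coeff (m.mapDomain some)) h
      rw [coeff_cauchyStep, if_pos (mapDomain_some_none m), some_mapDomain_some] at hm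
      rw [MvPolynomial.coeff_coe, hm]
      rfl

/-- The power series `V` and `W` agree modulo `t ^ k`. -/
def AgreeBelow (k : ℕ) (V W : SeriesZT n) : Prop :=
  ∀ m : Option (Fin n) →₀ ℕ, m none < k → MvPowerSeries.coeff m V = MvPowerSeries.coeff m W

/-- Products and derivatives in `z` preserve agreement modulo `t ^ k`, and integration in `t` gains
one order. The step is a `t`-adic contraction, which gives both uniqueness and existence. -/
theorem AgreeBelow.cauchyStep {k : ℕ} {V W : SeriesZT n} (h : AgreeBelow k V W)
    (P : MvPolynomial (Fin n) ℂ) : AgreeBelow (k + 1) (cauchyStep P V) (cauchyStep P W) := by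
  intro m hm
  rw [coeff_cauchyStep, coeff_cauchyStep]
  split_ifs with h0
  · rfl
  · obtain ⟨m', rfl⟩ := exists_eq_add_single_none h0
    rw [add_tsub_cancel_right]
    have hm' : m' none < k := by simpa using hm
    congr 1
    simp only [MvPowerSeries.coeff_smul, dotProduct, map_sum, MvPowerSeries.coeff_mul, gradientZ,
      MvPowerSeries.coeff_pderiv]
    congr 1
    refine Finset.sum_congr rfl fun i _ => Finset.sum_congr rfl fun p hp => ?_
    rw [Finset.HasAntidiagonal.mem_antidiagonal] at hp
    have hsum : p.1 none + p.2 none = m' none := by rw [← hp]; rfl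
    rw [h (p.1 + Finsupp.single (some i) 1) (by simp; omega),
      h (p.2 + Finsupp.single (some i) 1) (by simp; omega)]

theorem IsCauchySolution.unique {P : MvPolynomial (Fin n) ℂ} {U V : SeriesZT n}
    (hU : IsCauchySolution P U) (hV : IsCauchySolution P V) : U = V := by
  rw [isCauchySolution_iff] at hU hV
  have h : ∀ k, AgreeBelow k U V := by
    intro k
    induction k with
    | zero => intro m hm; omega
    | succ k ih => rw [← hU, ← hV]; exact ih.cauchyStep P
  ext m
  exact h _ m (Nat.lt_succ_self _)

theorem exists_isCauchySolution (P : MvPolynomial (Fin n) ℂ) : ∃ U, IsCauchySolution P U := by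
  let V : ℕ → SeriesZT n := fun k => (cauchyStep P)^[k] 0
  have hV : ∀ k, V (k + 1) = cauchyStep P (V k) := fun k => Function.iterate_succ_apply' _ _ _
  have h1 : ∀ k, AgreeBelow k (V k) (V (k + 1)) := by
    intro k
    induction k with
    | zero => intro m hm; omega
    | succ k ih =>
      have := ih.cauchyStep P
      rwa [← hV, ← hV] at this
  have h2 : ∀ k j, AgreeBelow k (V k) (V (k + j)) := by
    intro k j
    induction j with
    | zero => intro m _; rfl
    | succ j ih => exact fun m hm => (ih m hm).trans (h1 (k + j) m (by omega))
  -- `V k` is final only modulo `t ^ k`, so the coefficient of `t ^ (m none)` is read off the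
  -- iterate of index `m none + 1`.
  let U : SeriesZT n := fun m => MvPowerSeries.coeff m (V (m none + 1))
  have hU : ∀ k, AgreeBelow k U (V k) := by
    intro k m hm
    obtain ⟨j, rfl⟩ := Nat.exists_eq_add_of_le (Nat.succ_le_of_lt hm)
    exact h2 (m none + 1) j m (Nat.lt_succ_self _)
  refine ⟨U, isCauchySolution_iff.2 ?_⟩
  ext m
  rw [(hU (m none)).cauchyStep P m (Nat.lt_succ_self _), ← hV]
  rfl

end ExistsUnique

/-! ### Specialization of the time variable -/

section TimeZero

/-- The substitution `t = c` in polynomials in `z` and `t`. -/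
def evalTime {σ : Type*} (c : ℂ) : MvPolynomial (Option σ) ℂ →ₐ[ℂ] MvPolynomial σ ℂ :=
  aeval fun o => o.elim (C c) X

@[simp]
theorem evalTime_X_none {σ : Type*} (c : ℂ) :
    evalTime c (X none : MvPolynomial (Option σ) ℂ) = C c := by
  rw [evalTime, aeval_X]; rfl

@[simp]
theorem evalTime_X_some {σ : Type*} (c : ℂ) (i : σ) : evalTime c (X (some i)) = X i := by
  rw [evalTime, aeval_X]; rfl

@[simp]
theorem evalTime_rename_some {σ : Type*} (c : ℂ) (p : MvPolynomial σ ℂ) :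
    evalTime c (rename some p) = p := by
  rw [evalTime, aeval_rename]
  exact aeval_X_left_apply p

theorem pderiv_evalTime {σ : Type*} [Fintype σ] (c : ℂ) (i : σ) (p : MvPolynomial (Option σ) ℂ) :
    pderiv i (evalTime c p) = evalTime c (pderiv (some i) p) := by
  classical
  rw [evalTime, derivation_aeval, Fintype.sum_option, Finset.sum_eq_single i] <;>
    simp +contextual [pderiv_X, -aeval_eq_bind₁]

theorem coeff_evalTime_zero {σ : Type*} (p : MvPolynomial (Option σ) ℂ) (m : σ →₀ ℕ) :
    coeff m (evalTime 0 p) = coeff (m.mapDomain some) p := by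
  classical
  induction p using MvPolynomial.induction_on' with
  | add p q hp hq => rw [map_add, coeff_add, coeff_add, hp, hq]
  | monomial s c =>
    -- The convention `0 ^ 0 = 1` makes the factor `0 ^ s none` select the monomials free of `t`.
    have h : evalTime 0 (monomial s c) = C (c * 0 ^ s none) * monomial s.some (1 : ℂ) := by
      rw [evalTime, aeval_monomial, Finsupp.prod_option_index _ _ (by simp)
        (fun o a b => pow_add _ a b), algebraMap_eq, monomial_eq, map_mul, map_pow, map_zero, map_one,
        one_mul, mul_assoc]
      rfl
    rw [h, C_mul_monomial, mul_one, coeff_monomial, coeff_monomial]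
    by_cases hs : s = m.mapDomain some
    · subst hs
      simp [some_mapDomain_some, mapDomain_some_none]
    · rw [if_neg hs]
      by_cases h0 : s none = 0
      · rw [if_neg fun h => hs (by rw [← h, mapDomain_some_of_none_eq_zero h0])]
      · simp [h0]

theorem atTimeZero_coe {n : ℕ} (p : MvPolynomial (Option (Fin n)) ℂ) :
    atTimeZero (p : SeriesZT n) = (evalTime 0 p : MvPolynomial (Fin n) ℂ) := by
  ext m
  rw [MvPolynomial.coeff_coe, coeff_evalTime_zero, ← MvPolynomial.coeff_coe]
  rfl

theorem isCauchySolution_coe_iff {n : ℕ} {P : MvPolynomial (Fin n) ℂ}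
    {p : MvPolynomial (Option (Fin n)) ℂ} :
    IsCauchySolution P (p : SeriesZT n) ↔
      pderiv none p = C (1 / 2) * ∑ i, pderiv (some i) p * pderiv (some i) p ∧
        evalTime 0 p = P := by
  have hgrad : (1 / 2 : ℂ) • (gradientZ (p : SeriesZT n) ⬝ᵥ gradientZ (p : SeriesZT n)) =
      ((C (1 / 2) * ∑ i, pderiv (some i) p * pderiv (some i) p :
        MvPolynomial (Option (Fin n)) ℂ) : SeriesZT n) := by
    rw [C_mul', MvPolynomial.coe_smul]
    congr 1
    rw [← MvPolynomial.coeToMvPowerSeries.ringHom_apply (R := ℂ)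
      (φ := ∑ i, pderiv (some i) p * pderiv (some i) p), map_sum]
    refine Finset.sum_congr rfl fun i _ => ?_
    rw [map_mul, MvPolynomial.coeToMvPowerSeries.ringHom_apply, gradientZ,
      MvPowerSeries.pderiv_coe]
  constructor
  · rintro ⟨h1, h2⟩
    rw [hgrad, MvPowerSeries.pderiv_coe] at h1
    rw [atTimeZero_coe] at h2
    exact ⟨MvPolynomial.coe_injective _ _ h1, MvPolynomial.coe_injective _ _ h2⟩
  · rintro ⟨h1, h2⟩
    exact ⟨by rw [hgrad, MvPowerSeries.pderiv_coe, h1], by rw [atTimeZero_coe, h2]⟩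

end TimeZero

/-! ### Characteristics and the Hopf–Lax formula -/

section Characteristics

theorem pderiv_comm {R σ : Type*} [CommRing R] (i j : σ) (p : MvPolynomial σ R) :
    pderiv i (pderiv j p) = pderiv j (pderiv i p) := by
  classical
  let D (i : σ) : Derivation R (MvPolynomial σ R) (MvPolynomial σ R) := pderiv i
  have h : ⁅D i, D j⁆ = 0 := by
    refine MvPolynomial.derivation_ext fun k => ?_
    rw [Derivation.commutator_apply]
    simp [D, pderiv_X, Pi.single_apply, apply_ite]
  have := DFunLike.congr_fun h p
  rwa [Derivation.commutator_apply, Derivation.zero_apply, sub_eq_zero] at this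

/-- Uniqueness for homogeneous linear differential equations in `t`. -/
theorem eq_zero_of_pderiv_none_eq {σ ι : Type*} [Fintype ι]
    {D : ι → MvPolynomial (Option σ) ℂ} {A : ι → ι → MvPolynomial (Option σ) ℂ}
    (hD : ∀ i, pderiv none (D i) = ∑ j, D j * A i j) (h0 : ∀ i, evalTime 0 (D i) = 0) (i : ι) :
    D i = 0 := by
  classical
  -- Induction on the order in `t`: the equation determines the coefficients of `t ^ (k + 1)` from
  -- those up to `t ^ k`.
  have h : ∀ k : ℕ, ∀ m : Option σ →₀ ℕ, m none < k → ∀ i, coeff m (D i) = 0 := by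
    intro k
    induction k with
    | zero => intro m hm; omega
    | succ k ih =>
      intro m hm i
      by_cases hm0 : m none = 0
      · rw [← mapDomain_some_of_none_eq_zero hm0, ← coeff_evalTime_zero, h0, coeff_zero]
      · obtain ⟨m', rfl⟩ := exists_eq_add_single_none hm0
        have hm' : m' none < k := by simpa using hm
        have h1 := congrArg (coeff m') (hD i)
        rw [coeff_pderiv, coeff_sum, Finset.sum_eq_zero fun j _ => ?_] at h1
        · exact (mul_eq_zero.1 h1).resolve_right (Nat.cast_add_one_ne_zero _)
        · rw [coeff_mul]
          refine Finset.sum_eq_zero fun p hp => ?_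
          rw [Finset.HasAntidiagonal.mem_antidiagonal] at hp
          have hsum : p.1 none + p.2 none = m' none := by rw [← hp]; rfl
          rw [ih p.1 (by omega), zero_mul]
  ext m
  rw [h _ m (Nat.lt_succ_self _), coeff_zero]

variable {n : ℕ}

/-- The flow `(z, t) ↦ (z - t ∇P(z), t)` along characteristics, acting on polynomials. -/
def characteristicHom (P : MvPolynomial (Fin n) ℂ) :
    MvPolynomial (Option (Fin n)) ℂ →ₐ[ℂ] MvPolynomial (Option (Fin n)) ℂ :=
  aeval fun o => o.elim (X none) fun i => X (some i) - X none * rename some (pderiv i P)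

theorem pderiv_none_characteristicHom (P : MvPolynomial (Fin n) ℂ)
    (q : MvPolynomial (Option (Fin n)) ℂ) :
    pderiv none (characteristicHom P q) = characteristicHom P (pderiv none q) -
      ∑ j, rename some (pderiv j P) * characteristicHom P (pderiv (some j) q) := by
  rw [characteristicHom, derivation_aeval, Fintype.sum_option, sub_eq_add_neg,
    ← Finset.sum_neg_distrib]
  congr 1
  · simp [-aeval_eq_bind₁]
  · refine Finset.sum_congr rfl fun j _ => ?_
    have h0 : pderiv none (rename some (pderiv j P)) = 0 :=
      pderiv_rename_of_notMem_range (by simp) _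
    simp [-aeval_eq_bind₁, h0, mul_comm]

/-- The gradient satisfies the Burgers equation `∂ₜU_i = ∑ U_j ∂_jU_i`. Hence the difference `D_i`
of the two sides satisfies the linear system `∂ₜD_i = ∑ D_j A_ij`, with `A` the Hessian of `U` along
the flow. It vanishes at `t = 0`, where the flow is the identity, hence identically. -/
theorem characteristicHom_pderiv_of_isCauchySolution {P : MvPolynomial (Fin n) ℂ}
    {p : MvPolynomial (Option (Fin n)) ℂ} (hp : IsCauchySolution P (p : SeriesZT n)) (i : Fin n) :
    characteristicHom P (pderiv (some i) p) = rename some (pderiv i P) := by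
  obtain ⟨heq, hinit⟩ := isCauchySolution_coe_iff.1 hp
  have hburgers : ∀ i, pderiv none (pderiv (some i) p) =
      ∑ j, pderiv (some j) p * pderiv (some j) (pderiv (some i) p) := by
    intro i
    have hhalf : (C (1 / 2) * 2 : MvPolynomial (Option (Fin n)) ℂ) = 1 := by
      rw [show (2 : MvPolynomial (Option (Fin n)) ℂ) = C 2 from rfl, ← C_mul, ← C_1]
      norm_num
    rw [pderiv_comm, heq, pderiv_C_mul, map_sum, C_mul', Finset.smul_sum]
    refine Finset.sum_congr rfl fun j _ => ?_
    rw [pderiv_mul, pderiv_comm (some j) (some i), ← C_mul']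
    linear_combination (pderiv (some j) p * pderiv (some i) (pderiv (some j) p)) * hhalf
  rw [← sub_eq_zero]
  refine eq_zero_of_pderiv_none_eq
    (D := fun i => characteristicHom P (pderiv (some i) p) - rename some (pderiv i P))
    (A := fun i j => characteristicHom P (pderiv (some j) (pderiv (some i) p)))
    (fun i => ?_) (fun i => ?_) i
  · have h0 : pderiv none (rename some (pderiv i P)) = 0 :=
      pderiv_rename_of_notMem_range (by simp) _
    rw [map_sub, h0, sub_zero, pderiv_none_characteristicHom, hburgers, map_sum,
      ← Finset.sum_sub_distrib]
    refine Finset.sum_congr rfl fun j _ => ?_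
    rw [map_mul]
    ring
  · have hcomp : (evalTime 0).comp (characteristicHom P) = evalTime 0 := by
      ext1 o
      cases o <;> simp [characteristicHom, -aeval_eq_bind₁]
    have := DFunLike.congr_fun hcomp (pderiv (some i) p)
    rw [AlgHom.comp_apply] at this
    rw [map_sub, this, evalTime_rename_some, ← pderiv_evalTime, hinit, sub_self]

/-- If the solution of the Cauchy problem is a polynomial, then `z - ∇P(z)` is invertible. -/
theorem generates_of_isCauchySolution {P : MvPolynomial (Fin n) ℂ}
    {p : MvPolynomial (Option (Fin n)) ℂ} (hp : IsCauchySolution P (p : SeriesZT n)) :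
    Generates fun i => X i - pderiv i P := by
  -- The left inverse is `w ↦ w + ∇U(w, 1)`: at `w = z - ∇P(z)` the gradient equals `∇P(z)`.
  refine generates_of_forall_X fun i => ⟨X i + evalTime 1 (pderiv (some i) p), ?_⟩
  have hcomp : (aeval fun i => X i - pderiv i P).comp (evalTime 1) =
      (evalTime 1).comp (characteristicHom P) := by
    ext1 o
    cases o <;> simp [characteristicHom, -aeval_eq_bind₁]
  have := DFunLike.congr_fun hcomp (pderiv (some i) p)
  rw [AlgHom.comp_apply, AlgHom.comp_apply, characteristicHom_pderiv_of_isCauchySolution hp,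
    evalTime_rename_some] at this
  rw [map_add, this, aeval_X]
  ring

/-- The Hopf–Lax formula: an inverse of the characteristic flow yields a solution of the Cauchy
problem. -/
theorem isCauchySolution_of_inverse_flow {P : MvPolynomial (Fin n) ℂ}
    {g : Fin n → MvPolynomial (Option (Fin n)) ℂ}
    (hg : ∀ i, g i = X (some i) + X none * aeval g (pderiv i P)) :
    IsCauchySolution P ((aeval g P - C (1 / 2) * (X none *
      ∑ j, aeval g (pderiv j P) * aeval g (pderiv j P)) :
        MvPolynomial (Option (Fin n)) ℂ) : SeriesZT n) := by
  have hhalf : (C (1 / 2) * 2 : MvPolynomial (Option (Fin n)) ℂ) = 1 := by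
    rw [show (2 : MvPolynomial (Option (Fin n)) ℂ) = C 2 from rfl, ← C_mul, ← C_1]
    norm_num
  -- Differentiating `g = z + t∇P(g)` and substituting, the terms containing derivatives of `∇P(g)`
  -- cancel. What remains is `∇U = ∇P(g)` in space and `½⟨∇P(g), ∇P(g)⟩` in time, which is the
  -- equation.
  have hderiv : ∀ o, pderiv o (aeval g P - C (1 / 2) * (X none *
      ∑ j, aeval g (pderiv j P) * aeval g (pderiv j P))) =
        ∑ j, aeval g (pderiv j P) * pderiv o (X (some j)) + C (1 / 2) * (pderiv o (X none) *
          ∑ j, aeval g (pderiv j P) * aeval g (pderiv j P)) := by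
    intro o
    have hgo : ∀ j, pderiv o (g j) = pderiv o (X (some j)) +
        (pderiv o (X none) * aeval g (pderiv j P) +
          X none * pderiv o (aeval g (pderiv j P))) := by
      intro j
      conv_lhs => rw [hg j]
      rw [map_add, pderiv_mul]
    rw [map_sub, derivation_aeval, pderiv_C_mul, pderiv_mul, map_sum]
    simp only [hgo, pderiv_mul, C_mul', Finset.mul_sum, Finset.smul_sum, smul_add]
    simp only [← C_mul', ← Finset.sum_add_distrib, ← Finset.sum_sub_distrib]
    refine Finset.sum_congr rfl fun j _ => ?_
    linear_combination (-(pderiv o (X none) * aeval g (pderiv j P) * aeval g (pderiv j P) +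
      X none * aeval g (pderiv j P) * pderiv o (aeval g (pderiv j P)))) * hhalf
  have hspace : ∀ i, pderiv (some i) (aeval g P - C (1 / 2) * (X none *
      ∑ j, aeval g (pderiv j P) * aeval g (pderiv j P))) = aeval g (pderiv i P) := by
    intro i
    rw [hderiv, Finset.sum_eq_single i] <;>
      simp +contextual [pderiv_X, -aeval_eq_bind₁]
  refine isCauchySolution_coe_iff.2 ⟨?_, ?_⟩
  · simp only [hspace]
    rw [hderiv]
    simp [pderiv_X, -aeval_eq_bind₁]
  · have h0 : (evalTime 0).comp (aeval g) = AlgHom.id ℂ (MvPolynomial (Fin n) ℂ) := by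
      ext1 i
      rw [AlgHom.comp_apply, aeval_X, hg]
      simp [-aeval_eq_bind₁]
    have h1 := DFunLike.congr_fun h0 P
    rw [AlgHom.comp_apply, AlgHom.id_apply] at h1
    rw [map_sub, h1]
    simp [-aeval_eq_bind₁]

end Characteristics

/-! ### Transport between finite index types and `Fin n` -/

section Reindexing

theorem jac_rename_equiv {σ τ : Type*} [Fintype σ] [DecidableEq σ] (e : σ ≃ τ) (F : σ → MvPolynomial σ ℂ) :
    jac (fun i => rename e (F (e.symm i))) =
      Matrix.reindex e e
        ((rename e : MvPolynomial σ ℂ →ₐ[ℂ] MvPolynomial τ ℂ).mapMatrix (jac F)) := by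
  ext1 i j
  obtain ⟨j, rfl⟩ := e.surjective j
  simp only [jac_apply, Matrix.reindex_apply, Matrix.submatrix_apply, AlgHom.mapMatrix_apply,
    Matrix.map_apply, Equiv.symm_apply_apply]
  exact pderiv_rename e.injective j _

theorem isNilpotent_reindex_rename {σ τ : Type*} [Fintype σ] [Fintype τ] [DecidableEq σ]
    [DecidableEq τ] (e : σ ≃ τ) {M : Matrix σ σ (MvPolynomial σ ℂ)} (hM : IsNilpotent M) :
    IsNilpotent (Matrix.reindex e e
      ((rename e : MvPolynomial σ ℂ →ₐ[ℂ] MvPolynomial τ ℂ).mapMatrix M)) :=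
  (hM.map (rename e : MvPolynomial σ ℂ →ₐ[ℂ] MvPolynomial τ ℂ).mapMatrix).map
    (Matrix.reindexAlgEquiv ℂ (MvPolynomial τ ℂ) e)

theorem JacobianConjecture.exists_rightInverse (h : JacobianConjecture) {σ : Type} [Fintype σ]
    [DecidableEq σ] [Nonempty σ] {F : σ → MvPolynomial σ ℂ} (hF : (jac F).det = 1) :
    ∃ G : σ → MvPolynomial σ ℂ, ∀ i, aeval G (F i) = X i := by
  let e := Fintype.equivFin σ
  have hdet : (jacobianMatrix fun i => rename e (F (e.symm i))).det = 1 := by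
    change (jac fun i => rename e (F (e.symm i))).det = 1
    rw [jac_rename_equiv, Matrix.det_reindex_self, ← AlgHom.map_det, hF, map_one]
  obtain ⟨G, hG, -⟩ := h _ Fintype.card_pos _ hdet
  refine ⟨fun i => rename e.symm (G (e i)), fun i => ?_⟩
  have hcomp : aeval (fun i => rename e.symm (G (e i))) =
      (rename e.symm).comp ((aeval G).comp (rename (R := ℂ) e)) := by
    ext1 i
    simp [-aeval_eq_bind₁]
  have hi := hG (e i)
  simp only [Equiv.symm_apply_apply] at hi
  change aeval G (rename e (F i)) = X (e i) at hi
  rw [hcomp, AlgHom.comp_apply, AlgHom.comp_apply, hi, rename_X, Equiv.symm_apply_apply]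

end Reindexing

/-! ### From polynomial solutions to the Jacobian conjecture -/

theorem PolynomialSolutionConjecture.quarticGradientConjecture
    (h : PolynomialSolutionConjecture 4) : QuarticGradientConjecture := by
  intro σ _ _ _ P hP hnil
  let e := Fintype.equivFin σ
  have hgrad : ∀ i, pderiv i (rename e P) = rename e (pderiv (e.symm i) P) := fun i => by
    rw [← pderiv_rename e.injective, Equiv.apply_symm_apply]
  have hnil' : IsNilpotent (hessian (rename e P)) := by
    have : hessian (rename e P) = jac fun i => rename e (pderiv (e.symm i) P) :=
      congrArg jac (funext hgrad)
    rw [this, jac_rename_equiv e fun i => pderiv i P]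
    exact isNilpotent_reindex_rename e hnil
  obtain ⟨U, hU⟩ := exists_isCauchySolution (rename e P)
  obtain ⟨p, rfl⟩ := h _ Fintype.card_pos _ hP.rename_isHomogeneous hnil' U hU
  refine (generates_of_isCauchySolution hU).of_surjective (rename e.symm)
    (rename_surjective _ e.symm.surjective) fun i => ?_
  have : rename e.symm (X i - pderiv i (rename e P)) = X (e.symm i) - pderiv (e.symm i) P := by
    rw [hgrad, map_sub, rename_X, rename_rename, Equiv.symm_comp_self, rename_id_apply]
  rw [this]
  exact Algebra.subset_adjoin ⟨_, rfl⟩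

theorem PolynomialSolutionConjecture.jacobianConjecture (h : PolynomialSolutionConjecture 4) :
    JacobianConjecture := fun _ _ _ hF =>
  (h.quarticGradientConjecture.cubicHomogeneousConjecture.generates hF).exists_areInverse

/-! ### From the Jacobian conjecture to polynomial solutions -/

section Flow

variable {n : ℕ}

/-- The polynomial map `(z, t) ↦ (z - t ∇P(z), t)`. -/
def flowMap (P : MvPolynomial (Fin n) ℂ) : Fin n ⊕ Unit → MvPolynomial (Fin n ⊕ Unit) ℂ :=
  Sum.elim (fun i => X (.inl i) - X (.inr ()) * rename Sum.inl (pderiv i P))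
    fun _ => X (.inr ())

/-- The matrix is block triangular with diagonal blocks `1 - T Hess P` and 1, and `T Hess P` is
nilpotent. -/
theorem det_jac_flowMap {P : MvPolynomial (Fin n) ℂ} (hP : IsNilpotent (hessian P)) :
    (jac (flowMap P)).det = 1 := by
  let T : MvPolynomial (Fin n ⊕ Unit) ℂ := X (.inr ())
  let ι : MvPolynomial (Fin n) ℂ →ₐ[ℂ] MvPolynomial (Fin n ⊕ Unit) ℂ := rename Sum.inl
  have hblock : jac (flowMap P) = Matrix.fromBlocks (1 - T • ι.mapMatrix (hessian P))
      (Matrix.of fun i j => jac (flowMap P) (.inl i) (.inr j)) 0 1 := by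
    refine Matrix.ext fun i j => ?_
    rcases i with i | i <;> rcases j with j | j <;>
      simp [flowMap, hessian, jacobianMatrix, polyGradient, pderiv_inl_rename_inl, pderiv_X,
        Pi.single_apply, Matrix.one_apply, T, ι, eq_comm]
  rw [hblock, Matrix.det_fromBlocks_zero₂₁, Matrix.det_one, mul_one]
  exact det_one_sub_of_isNilpotent ((hP.map ι.mapMatrix).smul T)

/-- The inverse `G` of the flow map fixes `t`, so its spatial components solve `g = z + t∇P(g)`, as
the Hopf–Lax formula requires. -/
theorem exists_polynomial_isCauchySolution (h : JacobianConjecture) {P : MvPolynomial (Fin n) ℂ}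
    (hP : IsNilpotent (hessian P)) :
    ∃ p : MvPolynomial (Option (Fin n)) ℂ, IsCauchySolution P (p : SeriesZT n) := by
  obtain ⟨G, hG⟩ := h.exists_rightInverse (det_jac_flowMap hP)
  let s : Fin n ⊕ Unit → Option (Fin n) := Sum.elim some fun _ => none
  have hT : G (.inr ()) = X (.inr ()) := by
    simpa [flowMap] using hG (.inr ())
  refine ⟨_, isCauchySolution_of_inverse_flow (g := fun i => rename s (G (.inl i))) fun i => ?_⟩
  have hcomp : aeval (fun i => rename s (G (.inl i))) =
      (rename s).comp ((aeval G).comp (rename (R := ℂ) Sum.inl)) := by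
    ext1 i
    simp [-aeval_eq_bind₁]
  have hi : G (.inl i) - X (.inr ()) * aeval G (rename Sum.inl (pderiv i P)) = X (.inl i) := by
    have := hG (.inl i)
    rwa [flowMap, Sum.elim_inl, map_sub, map_mul, aeval_X, aeval_X, hT] at this
  rw [hcomp, AlgHom.comp_apply, AlgHom.comp_apply]
  have hi' := congrArg (rename s) hi
  rw [map_sub, map_mul, rename_X, rename_X] at hi'
  exact sub_eq_iff_eq_add.1 hi'

theorem JacobianConjecture.polynomialSolutionConjecture (h : JacobianConjecture) (d : ℕ) :
    PolynomialSolutionConjecture d := by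
  intro n _ P _ hP U hU
  obtain ⟨p, hp⟩ := exists_polynomial_isCauchySolution h hP
  exact ⟨p, hp.unique hU⟩

end Flow

end InviscidBurgers

end

theorem proposition4p2 :
    (∀ n : ℕ, 1 ≤ n → ∀ P : MvPolynomial (Fin n) ℂ, P.IsHomogeneous 4 →
      IsNilpotent (InviscidBurgers.hessian P) →
        ∃! U : InviscidBurgers.SeriesZT n, InviscidBurgers.IsCauchySolution P U) ∧
    (InviscidBurgers.PolynomialSolutionConjecture 4 ↔ InviscidBurgers.JacobianConjecture) := by
  refine ⟨fun n _ P _ _ => ?_, fun h => h.jacobianConjecture,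
    fun h => h.polynomialSolutionConjecture 4⟩
  obtain ⟨U, hU⟩ := InviscidBurgers.exists_isCauchySolution P
  exact ⟨U, hU, fun V hV => hV.unique hU⟩
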